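/- Let $n\ge 1$, $1\le p<\infty$ and $\nu\ge 1$. Cubes $Q\subset\mathbb R^n$ have sides parallel to the axes and positive side length; $w(Q)=\int_Q w$, and $M$ is the (uncentred) Hardy--Littlewood maximal operator over cubes. For $v\ge 0$ and a measurable complex function $f$ put $\|f\|_{L_{p,v}(S)}=(\int_S|f|^pv)^{1/p}$, and for $-n/p\le r<0$ let $L^r_p(w)$ and $L^r_p(\lambda,w)$ be the spaces of (classes of) measurable $f:\mathbb R^n\to\mathbb C$ with finite norm $$\|f\|_{L^r_p(w)}=\sup_Q w(Q)^{-(\frac1p+\frac rn)}\|f\|_{L_{p,w}(Q)},\qquad \|f\|_{L^r_p(\lambda,w)}=\sup_Q |Q|^{-(\frac1p+\frac rn)}\|f\|_{L_{p,w}(Q)} .$$ Let $\sigma>\nu$ and $w\in A_1\cap RH_\sigma$; that is, $w$ is locally integrable, $w>0$ a.e., and there is a constant $c$ such that for all cubes $Q$, $\frac{w(Q)}{|Q|}\le c\,w(x)$ for a.e. $x\in Q$, and $\big(\frac1{|Q|}\int_Q w^\sigma\big)^{1/\sigma}\le \frac{c}{|Q|}\int_Q w$. Write $\sigma'=\sigma/(\sigma-1)$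 and $1/\nu'=1-1/\nu$. Let $-n/p\le r<0$, and consider the conditions $$\text{(i)}\quad r\le -\frac{n\sigma'}{p\nu'},\qquad\qquad \text{(ii)}\quad r\le -\frac np\Big(\frac1\sigma+\frac1{\nu'}\Big).$$ (a) There is $s_0>\nu$ such that the following holds. If (i) holds, there is a constant $C<\infty$ such that for all $\nu<s\le s_0$ and every cube $Q$, $L^r_p(w)\subset L_{p,M(w^s\chi_Q)^{1/s}}(\mathbb R^n)$ with $$\|f\|_{L_{p,M(w^s\chi_Q)^{1/s}}(\mathbb R^n)}\le C\,w(Q)^{\frac1p+\frac rn}\,\|f\|_{L^r_p(w)} .$$ If (ii) holds, there is a constant $C<\infty$ such that for all $\nu<s\le s_0$ and every cube $Q$, $L^r_p(\lambda,w)\subset L_{p,M(w^s\chi_Q)^{1/s}}(\mathbb R^n)$ with $$\|f\|_{L_{p,M(w^s\chi_Q)^{1/s}}(\mathbb R^n)}\le C\,|Q|^{\frac1p+\frac rn}\,\|f\|_{L^r_p(\lambda,w)} .$$ (b) There is $\alpha$ with $0<\alpha<n/\nu$ such that $L^r_p(w)$ (if (i) holds) and $L^r_p(\lambda,w)$ (if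 (ii) holds) embed continuously into $L_{p,(1+|x|)^{-\alpha}}(\mathbb R^n)$. -/

import Mathlib

open MeasureTheory Set
open scoped ENNReal NNReal

noncomputable section

namespace WeightedMorrey

/-- The (closed, nondegenerate when `0 < ℓ`) cube in `ℝⁿ` with sides parallel to the coordinate
axes, centre `a` and side length `ℓ`. -/
def cube {n : ℕ} (a : EuclideanSpace ℝ (Fin n)) (ℓ : ℝ) : Set (EuclideanSpace ℝ (Fin n)) :=
  {x | ∀ i, |x i - a i| ≤ ℓ / 2}

/-- The measure `w(S) = ∫_S w(x) dx` of a set `S` for a weight `w`. -/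
def mass {n : ℕ} (w : EuclideanSpace ℝ (Fin n) → ℝ) (S : Set (EuclideanSpace ℝ (Fin n))) : ℝ≥0∞ :=
  ∫⁻ x in S, ENNReal.ofReal (w x)

/-- The Muckenhoupt class `A_1`: `w` is locally integrable, positive almost everywhere, and for
some constant `c`, every cube `Q` satisfies `w(Q) / |Q| ≤ c w(x)` for almost all `x ∈ Q`. -/
structure IsA1 {n : ℕ} (w : EuclideanSpace ℝ (Fin n) → ℝ) : Prop where
  locallyIntegrable : LocallyIntegrable w volume
  pos : ∀ᵐ x, 0 < w x
  bound : ∃ c : ℝ≥0, ∀ (a : EuclideanSpace ℝ (Fin n)) (ℓ : ℝ), 0 < ℓ →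
    ∀ᵐ x ∂(volume.restrict (cube a ℓ)),
      mass w (cube a ℓ) / volume (cube a ℓ) ≤ c * ENNReal.ofReal (w x)

/-- The reverse Hölder class `RH_σ`: `w` is locally integrable, nonnegative (almost everywhere), and
`(|Q|⁻¹ ∫_Q w^σ)^{1/σ} ≤ c |Q|⁻¹ ∫_Q w` for all cubes `Q`, with `c` independent of `Q`. -/
structure IsRH {n : ℕ} (σ : ℝ) (w : EuclideanSpace ℝ (Fin n) → ℝ) : Prop where
  locallyIntegrable : LocallyIntegrable w volume
  nonneg : ∀ᵐ x, 0 ≤ w x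
  bound : ∃ c : ℝ≥0, ∀ (a : EuclideanSpace ℝ (Fin n)) (ℓ : ℝ), 0 < ℓ →
    ((∫⁻ x in cube a ℓ, ENNReal.ofReal (w x) ^ σ) / volume (cube a ℓ)) ^ (1 / σ)
      ≤ c * (mass w (cube a ℓ) / volume (cube a ℓ))

/-- The (uncentred) Hardy–Littlewood maximal function of a nonnegative function `g`. -/
def maximal {n : ℕ} (g : EuclideanSpace ℝ (Fin n) → ℝ≥0∞) (x : EuclideanSpace ℝ (Fin n)) : ℝ≥0∞ :=
  ⨆ (a : EuclideanSpace ℝ (Fin n)) (ℓ : ℝ) (_ : 0 < ℓ) (_ : x ∈ cube a ℓ),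
    (∫⁻ y in cube a ℓ, g y) / volume (cube a ℓ)

/-- The function `M(w^s χ_Q)^{1/s}`. -/
def maximalWeight {n : ℕ} (w : EuclideanSpace ℝ (Fin n) → ℝ) (s : ℝ)
    (Q : Set (EuclideanSpace ℝ (Fin n))) (x : EuclideanSpace ℝ (Fin n)) : ℝ≥0∞ :=
  maximal (Q.indicator fun y => ENNReal.ofReal (w y) ^ s) x ^ (1 / s)

/-- The norm `‖f | L_{p,v}(S)‖ = (∫_S |f|^p v)^{1/p}` with values in `[0, ∞]`. -/
def weightedLpNorm {n : ℕ} (p : ℝ) (v : EuclideanSpace ℝ (Fin n) → ℝ≥0∞)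
    (S : Set (EuclideanSpace ℝ (Fin n))) (f : EuclideanSpace ℝ (Fin n) →ₘ[volume] ℂ) : ℝ≥0∞ :=
  (∫⁻ x in S, ‖f x‖ₑ ^ p * v x) ^ (1 / p)

/-- The norm of the Morrey space `L^r_p(w, ℝⁿ)`:
`sup_Q w(Q)^{-(1/p + r/n)} ‖f | L_{p,w}(Q)‖`. -/
def morreyNorm {n : ℕ} (p r : ℝ) (w : EuclideanSpace ℝ (Fin n) → ℝ)
    (f : EuclideanSpace ℝ (Fin n) →ₘ[volume] ℂ) : ℝ≥0∞ :=
  ⨆ (a : EuclideanSpace ℝ (Fin n)) (ℓ : ℝ) (_ : 0 < ℓ),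
    mass w (cube a ℓ) ^ (-(1 / p + r / n)) *
      weightedLpNorm p (fun x => ENNReal.ofReal (w x)) (cube a ℓ) f

/-- The norm of the Morrey space `L^r_p(λ, w, ℝⁿ)` (with `λ` Lebesgue measure):
`sup_Q |Q|^{-(1/p + r/n)} ‖f | L_{p,w}(Q)‖`. -/
def morreyLebesgueNorm {n : ℕ} (p r : ℝ) (w : EuclideanSpace ℝ (Fin n) → ℝ)
    (f : EuclideanSpace ℝ (Fin n) →ₘ[volume] ℂ) : ℝ≥0∞ :=
  ⨆ (a : EuclideanSpace ℝ (Fin n)) (ℓ : ℝ) (_ : 0 < ℓ),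
    volume (cube a ℓ) ^ (-(1 / p + r / n)) *
      weightedLpNorm p (fun x => ENNReal.ofReal (w x)) (cube a ℓ) f

/-- The Lebesgue space `L_{p,v}(ℝⁿ)`, as a set of classes of measurable complex functions. -/
def lpSpace {n : ℕ} (p : ℝ) (v : EuclideanSpace ℝ (Fin n) → ℝ≥0∞) :
    Set (EuclideanSpace ℝ (Fin n) →ₘ[volume] ℂ) :=
  {f | weightedLpNorm p v univ f < ∞}

/-- The Morrey space `L^r_p(w, ℝⁿ)`. -/
def morreySpace {n : ℕ} (p r : ℝ) (w : EuclideanSpace ℝ (Fin n) → ℝ) :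
    Set (EuclideanSpace ℝ (Fin n) →ₘ[volume] ℂ) :=
  {f | morreyNorm p r w f < ∞}

/-- The Morrey space `L^r_p(λ, w, ℝⁿ)`. -/
def morreyLebesgueSpace {n : ℕ} (p r : ℝ) (w : EuclideanSpace ℝ (Fin n) → ℝ) :
    Set (EuclideanSpace ℝ (Fin n) →ₘ[volume] ℂ) :=
  {f | morreyLebesgueNorm p r w f < ∞}

/-- `L^r_p(w, ℝⁿ)` embeds continuously into `L_{p,v}(ℝⁿ)` with constant `C`. -/
def MorreyEmbeds {n : ℕ} (p r : ℝ) (w : EuclideanSpace ℝ (Fin n) → ℝ)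
    (v : EuclideanSpace ℝ (Fin n) → ℝ≥0∞) (C : ℝ≥0∞) : Prop :=
  ∀ f ∈ morreySpace p r w, f ∈ lpSpace p v ∧ weightedLpNorm p v univ f ≤ C * morreyNorm p r w f

/-- `L^r_p(λ, w, ℝⁿ)` embeds continuously into `L_{p,v}(ℝⁿ)` with constant `C`. -/
def MorreyLebesgueEmbeds {n : ℕ} (p r : ℝ) (w : EuclideanSpace ℝ (Fin n) → ℝ)
    (v : EuclideanSpace ℝ (Fin n) → ℝ≥0∞) (C : ℝ≥0∞) : Prop :=
  ∀ f ∈ morreyLebesgueSpace p r w,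
    f ∈ lpSpace p v ∧ weightedLpNorm p v univ f ≤ C * morreyLebesgueNorm p r w f

/-- The weight `(1 + |x|)^{-α}`, with `|x|` the Euclidean norm. -/
def powerWeight {n : ℕ} (α : ℝ) (x : EuclideanSpace ℝ (Fin n)) : ℝ≥0∞ :=
  ENNReal.ofReal ((1 + ‖x‖) ^ (-α))

end WeightedMorrey

end

/-! The conditions (i) and (ii) include their endpoints, where the naive geometric series would have
ratio exactly 1, so a strict gain is needed. It comes from `w ^ σ`: by `A_1` and `RH_σ` this power
satisfies the `A_1` inequality itself, hence reverse doubling (`exists_reverse_doubling`): passing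
from `2Q` to `Q` loses a fixed proportion of its integral. Comparing averages of `w` with those of
`w ^ σ` gives `avg Q ≤ d * ρ ^ k * avg (2 ^ k Q)` with `ρ` strictly below `2 ^ (n / σ)`
(`exists_avg_decay`).

Off `2 ^ k Q`, a cube that contains the point and meets `Q` has side comparable to `2 ^ k ℓ` or
larger, so `M(w^s χ_Q)^{1/s}` is at most a constant times `2 ^ (-k n / s) * avg Q`. On `2 ^ (k + 1)
Q` the `A_1` condition replaces `avg (2 ^ (k + 1) Q)` by `w x`. Thus the maximal weight is dominated
by a sum of multiples of `w` on dyadic dilates (`exists_maximalWeight_le_tsum`), and integrating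
`|f|^p` against it leaves a geometric series in the Morrey norm (`exists_weightedLpNorm_le`). Under
(i) or (ii) its ratio at `s = ν` is strictly below 1, thanks to the strict bound on `ρ`; by
continuity it stays so at some `s₀ > ν`, and `s₀` also controls all smaller `s`.

For (b), the power weight with `α = n / s₀` is dominated by the maximal weight of one fixed cube. -/

namespace WeightedMorrey

variable {n : ℕ}

/-! ### Cubes, power means and the mass of a weight. -/

lemma cube_eq_preimage (a : EuclideanSpace ℝ (Fin n)) (ℓ : ℝ) :
    cube a ℓ = (WithLp.ofLp : EuclideanSpace ℝ (Fin n) → (Fin n → ℝ)) ⁻¹'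
      Icc (fun i => a i - ℓ / 2) (fun i => a i + ℓ / 2) := by
  ext x
  simp only [cube, mem_ofPred_eq, mem_preimage, mem_Icc, Pi.le_def, abs_le]
  constructor
  · intro h
    exact ⟨fun i => by linarith [(h i).1], fun i => by linarith [(h i).2]⟩
  · rintro ⟨h1, h2⟩ i
    exact ⟨by linarith [h1 i], by linarith [h2 i]⟩

lemma measurableSet_cube (a : EuclideanSpace ℝ (Fin n)) (ℓ : ℝ) : MeasurableSet (cube a ℓ) := by
  rw [cube_eq_preimage]
  exact (PiLp.volume_preserving_ofLp (Fin n)).measurable measurableSet_Icc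

lemma volume_cube (a : EuclideanSpace ℝ (Fin n)) (ℓ : ℝ) :
    volume (cube a ℓ) = ENNReal.ofReal ℓ ^ n := by
  rw [cube_eq_preimage, (PiLp.volume_preserving_ofLp (Fin n)).measure_preimage
    measurableSet_Icc.nullMeasurableSet, Real.volume_Icc_pi]
  have (x : Fin n) : a x + ℓ / 2 - (a x - ℓ / 2) = ℓ := by ring
  simp [this]

lemma volume_cube_pos (a : EuclideanSpace ℝ (Fin n)) {ℓ : ℝ} (h : 0 < ℓ) :
    volume (cube a ℓ) ≠ 0 := by
  rw [volume_cube]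
  exact pow_ne_zero _ (by simpa using h)

lemma volume_cube_ne_top (a : EuclideanSpace ℝ (Fin n)) (ℓ : ℝ) : volume (cube a ℓ) ≠ ∞ := by
  rw [volume_cube]
  exact ENNReal.pow_ne_top ENNReal.ofReal_ne_top

lemma isCompact_cube (a : EuclideanSpace ℝ (Fin n)) (ℓ : ℝ) : IsCompact (cube a ℓ) := by
  rw [cube_eq_preimage]
  exact (PiLp.homeomorph 2 (fun _ : Fin n => ℝ)).isCompact_preimage.2 isCompact_Icc

lemma cube_mono (a : EuclideanSpace ℝ (Fin n)) {ℓ ℓ' : ℝ} (h : ℓ ≤ ℓ') :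
    cube a ℓ ⊆ cube a ℓ' := fun x hx i => (hx i).trans (by linarith)

/-- The power mean inequality on a set of finite positive measure. -/
lemma rpow_average_le {α : Type*} [MeasurableSpace α] {μ : Measure α} {S : Set α}
    (hS : μ S ≠ 0) (hS' : μ S ≠ ∞) {g : α → ℝ≥0∞} (hg : AEMeasurable g μ) {s t : ℝ} (hs : 0 < s)
    (hst : s ≤ t) :
    ((∫⁻ x in S, g x ^ s ∂μ) / μ S) ^ (1 / s) ≤ ((∫⁻ x in S, g x ^ t ∂μ) / μ S) ^ (1 / t) := by
  have ht : 0 < t := hs.trans_le hst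
  have h := eLpNorm'_le_eLpNorm'_mul_rpow_measure_univ (μ := μ.restrict S) (f := g) hs hst
    hg.restrict.aestronglyMeasurable
  simp only [eLpNorm', enorm_eq_self, Measure.restrict_apply_univ] at h
  rw [ENNReal.div_rpow_of_nonneg _ _ (by positivity), ENNReal.div_rpow_of_nonneg _ _ (by positivity)]
  have h0 : μ S ^ (1 / s) ≠ 0 := by simp [hS, hS', ENNReal.rpow_eq_zero_iff]
  have h1 : μ S ^ (1 / s) ≠ ∞ := ENNReal.rpow_ne_top_of_nonneg (by positivity) hS'
  rw [ENNReal.div_le_iff h0 h1]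
  refine h.trans (le_of_eq ?_)
  rw [ENNReal.rpow_sub _ _ hS hS']
  simp only [div_eq_mul_inv]
  ring

section weight

variable {w : EuclideanSpace ℝ (Fin n) → ℝ}

lemma aemeasurable_of_locallyIntegrable (hw : LocallyIntegrable w volume) :
    AEMeasurable (fun x => ENNReal.ofReal (w x)) volume :=
  hw.aestronglyMeasurable.aemeasurable.ennreal_ofReal

lemma mass_cube_ne_top (hw : LocallyIntegrable w volume) (a : EuclideanSpace ℝ (Fin n)) (ℓ : ℝ) :
    mass w (cube a ℓ) ≠ ∞ := by
  have h := (hw.integrableOn_isCompact (isCompact_cube a ℓ)).2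
  refine ne_top_of_le_ne_top h.ne (lintegral_mono fun x => ?_)
  exact Real.ofReal_le_enorm _

lemma mass_cube_ne_zero (hw : AEMeasurable (fun x => ENNReal.ofReal (w x)) volume)
    (hpos : ∀ᵐ x, 0 < w x) (a : EuclideanSpace ℝ (Fin n)) {ℓ : ℝ} (hℓ : 0 < ℓ) :
    mass w (cube a ℓ) ≠ 0 := by
  intro h
  rw [mass, lintegral_eq_zero_iff' hw.restrict] at h
  have h2 : ∀ᵐ x ∂(volume.restrict (cube a ℓ)), False := by
    filter_upwards [h, ae_restrict_of_ae hpos] with x hx hx'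
    simp only [Pi.zero_apply, ENNReal.ofReal_eq_zero] at hx
    linarith
  rw [ae_iff] at h2
  simp [volume_cube_pos a hℓ] at h2

end weight

/-! ### Consequences of the `A_1` inequality: reverse doubling, pointwise bounds, doubling. -/

lemma volume_cube_mul (a b : EuclideanSpace ℝ (Fin n)) {c : ℝ} (hc : 0 ≤ c) (ℓ : ℝ) :
    volume (cube a (c * ℓ)) = ENNReal.ofReal (c ^ n) * volume (cube b ℓ) := by
  rw [volume_cube, volume_cube, ENNReal.ofReal_mul hc, mul_pow, ENNReal.ofReal_pow hc]

/-- Reverse doubling for weights satisfying the `A_1` inequality. -/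
lemma exists_reverse_doubling (hn : 0 < n) {g : EuclideanSpace ℝ (Fin n) → ℝ≥0∞} {K : ℝ≥0}
    (hg : ∀ (a : EuclideanSpace ℝ (Fin n)) (ℓ : ℝ), ∫⁻ x in cube a ℓ, g x ≠ ∞)
    (hK : ∀ (a : EuclideanSpace ℝ (Fin n)) (ℓ : ℝ), 0 < ℓ →
      ∀ᵐ x ∂(volume.restrict (cube a ℓ)),
        (∫⁻ y in cube a ℓ, g y) / volume (cube a ℓ) ≤ K * g x) :
    ∃ θ : ℝ, 0 < θ ∧ θ < 1 ∧ ∀ (a : EuclideanSpace ℝ (Fin n)) (ℓ : ℝ), 0 < ℓ →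
      ∫⁻ x in cube a ℓ, g x ≤ ENNReal.ofReal θ * ∫⁻ x in cube a (2 * ℓ), g x := by
  -- The maximum with 1 keeps `θ = 1 - 1 / (2 * L)` strictly between 0 and 1.
  set L : ℝ := max K 1 with hL
  have hL1 : 1 ≤ L := le_max_right _ _
  have hi : 1 / (2 * L) ≤ 1 / 2 := by
    apply one_div_le_one_div_of_le <;> linarith
  have hi0 : 0 < 1 / (2 * L) := by positivity
  refine ⟨1 - 1 / (2 * L), by linarith, by linarith, fun a ℓ hℓ => ?_⟩
  have hsub : cube a ℓ ⊆ cube a (2 * ℓ) := cube_mono a (by linarith)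
  set D := cube a (2 * ℓ)
  set Q := cube a ℓ
  have hD0 : volume D ≠ 0 := volume_cube_pos a (by linarith)
  have hDt : volume D ≠ ∞ := volume_cube_ne_top a _
  have hvol : volume D = ENNReal.ofReal (2 ^ n) * volume Q := volume_cube_mul a a (by norm_num) ℓ
  -- Here `n ≥ 1` enters: doubling the side at least doubles the volume, so `D \ Q` has at least
  -- half of `D`.
  have hhalf : volume D ≤ 2 * volume (D \ Q) := by
    have h1 : 2 * volume Q ≤ volume D := by
      rw [hvol]
      gcongr
      rw [← ENNReal.ofReal_ofNat]
      exact ENNReal.ofReal_le_ofReal (by simpa using pow_le_pow_right₀ (a := (2:ℝ)) (by norm_num) hn)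
    have h2 : volume Q + volume (D \ Q) = volume D := by
      rw [add_comm]
      nth_rewrite 2 [← inter_eq_right.2 hsub]
      exact measure_sdiff_add_inter D (measurableSet_cube a ℓ)
    rw [← h2, two_mul] at h1
    rw [← h2, two_mul]
    exact add_le_add_left ((ENNReal.add_le_add_iff_left (volume_cube_ne_top a ℓ)).1 h1) _
  have hsum : ∫⁻ x in D, g x = (∫⁻ x in Q, g x) + ∫⁻ x in D \ Q, g x := by
    have := lintegral_inter_add_sdiff (μ := volume) g D (measurableSet_cube a ℓ)
    rw [← this, inter_eq_right.2 hsub]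
  have hKL : (K : ℝ≥0∞) ≤ ENNReal.ofReal L := by
    rw [← ENNReal.ofReal_coe_nnreal]; exact ENNReal.ofReal_le_ofReal (le_max_left _ _)
  -- Integrating the `A_1` inequality of `D` over `D \ Q` shows that this part carries at least the
  -- fraction `1 / (2 * L)` of the integral.
  have hlow : (∫⁻ x in D, g x) ≤ 2 * ENNReal.ofReal L * ∫⁻ x in D \ Q, g x := by
    have h1 : (∫⁻ y in D, g y) / volume D * volume (D \ Q)
        ≤ ENNReal.ofReal L * ∫⁻ x in D \ Q, g x := by
      rw [← setLIntegral_const, ← lintegral_const_mul' _ _ ENNReal.ofReal_ne_top]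
      refine lintegral_mono_ae ?_
      filter_upwards [ae_restrict_of_ae_restrict_of_subset sdiff_subset (hK a (2 * ℓ) (by linarith))]
        with x hx
      exact hx.trans (by gcongr)
    calc (∫⁻ x in D, g x) = (∫⁻ x in D, g x) / volume D * volume D :=
          (ENNReal.div_mul_cancel hD0 hDt).symm
      _ ≤ (∫⁻ x in D, g x) / volume D * (2 * volume (D \ Q)) := by gcongr
      _ = 2 * ((∫⁻ x in D, g x) / volume D * volume (D \ Q)) := by ring
      _ ≤ _ := by rw [mul_assoc]; gcongr
  have hQt : ∫⁻ x in Q, g x ≠ ∞ := hg _ _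
  have hDQt : ∫⁻ x in D \ Q, g x ≠ ∞ :=
    ne_top_of_le_ne_top (hg a (2 * ℓ)) (lintegral_mono_set sdiff_subset)
  rw [hsum] at hlow ⊢
  generalize ∫⁻ x in Q, g x = q at *
  generalize ∫⁻ x in D \ Q, g x = d at *
  lift q to ℝ≥0 using hQt
  lift d to ℝ≥0 using hDQt
  have e2 : (2 : ℝ≥0∞) = ENNReal.ofReal 2 := by simp
  rw [e2, ← ENNReal.ofReal_coe_nnreal, ← ENNReal.ofReal_coe_nnreal (p := d),
    ← ENNReal.ofReal_add (by positivity) (by positivity), ← ENNReal.ofReal_mul (by norm_num),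
    ← ENNReal.ofReal_mul (by positivity), ENNReal.ofReal_le_ofReal_iff (by positivity)] at hlow
  rw [← ENNReal.ofReal_coe_nnreal, ← ENNReal.ofReal_coe_nnreal (p := d),
    ← ENNReal.ofReal_add (by positivity) (by positivity), ← ENNReal.ofReal_mul (by linarith)]
  apply ENNReal.ofReal_le_ofReal
  have : (q + d : ℝ) * (1 / (2 * L)) ≤ d := by
    rw [mul_one_div, div_le_iff₀ (by positivity)]; linarith
  linarith

/-- For an `A_1` weight, almost every point satisfies the `A_1` inequality for all cubes
containing it. -/
lemma ae_forall_cube_average_le {g : EuclideanSpace ℝ (Fin n) → ℝ≥0∞} {K : ℝ≥0}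
    (hK : ∀ (a : EuclideanSpace ℝ (Fin n)) (ℓ : ℝ), 0 < ℓ →
      ∀ᵐ x ∂(volume.restrict (cube a ℓ)),
        (∫⁻ y in cube a ℓ, g y) / volume (cube a ℓ) ≤ K * g x) :
    ∀ᵐ x, ∀ (a : EuclideanSpace ℝ (Fin n)) (ℓ : ℝ), 0 < ℓ → x ∈ cube a ℓ →
      (∫⁻ y in cube a ℓ, g y) / volume (cube a ℓ) ≤ ENNReal.ofReal (2 ^ n) * K * g x := by
  -- Only countably many cubes may share one null set, so every cube is enlarged to one with centre
  -- in a dense sequence and rational side.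
  let d := TopologicalSpace.denseSeq (EuclideanSpace ℝ (Fin n))
  have h : ∀ᵐ x, ∀ (i : ℕ) (q : ℚ), 0 < (q : ℝ) → x ∈ cube (d i) q →
      (∫⁻ y in cube (d i) q, g y) / volume (cube (d i) q) ≤ K * g x := by
    rw [ae_all_iff]; intro i
    rw [ae_all_iff]; intro q
    by_cases hq : 0 < (q : ℝ)
    · filter_upwards [(ae_restrict_iff' (measurableSet_cube _ _)).1 (hK (d i) q hq)] with x hx _
      exact hx
    · exact Filter.Eventually.of_forall fun x h => absurd h hq
  filter_upwards [h] with x hx a ℓ hℓ hxa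
  obtain ⟨i, hi⟩ := (TopologicalSpace.denseRange_denseSeq
    (EuclideanSpace ℝ (Fin n))).exists_dist_lt a (ε := ℓ / 4) (by linarith)
  -- Moving the centre by less than `ℓ / 4` needs a side of `3 * ℓ / 2` to cover the old cube;
  -- staying below `2 * ℓ` costs at most `2 ^ n` in volume.
  obtain ⟨q, hq1, hq2⟩ := exists_rat_btwn (show 3 * ℓ / 2 < 2 * ℓ by linarith)
  have hsub : cube a ℓ ⊆ cube (d i) q := by
    intro y hy j
    have h1 := hy j
    have h2 : |a j - d i j| ≤ dist a (d i) := by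
      rw [dist_eq_norm]
      exact PiLp.norm_apply_le (a - d i) j
    have h3 := abs_sub_le (y j) (a j) (d i j)
    have : dist a (d i) < ℓ / 4 := hi
    linarith
  have h0 : 0 < (q : ℝ) := by linarith
  have hv : volume (cube (d i) q) ≤ ENNReal.ofReal (2 ^ n) * volume (cube a ℓ) := by
    rw [← volume_cube_mul (d i) a (by norm_num)]
    exact measure_mono (cube_mono _ hq2.le)
  have hv0 := volume_cube_pos a hℓ
  have hvt := volume_cube_ne_top a ℓ
  rw [ENNReal.div_le_iff hv0 hvt]
  calc ∫⁻ y in cube a ℓ, g y ≤ ∫⁻ y in cube (d i) q, g y := lintegral_mono_set hsub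
    _ ≤ K * g x * volume (cube (d i) q) :=
      (ENNReal.div_le_iff (volume_cube_pos _ h0) (volume_cube_ne_top _ _)).1 (hx i q h0 (hsub hxa))
    _ ≤ K * g x * (ENNReal.ofReal (2 ^ n) * volume (cube a ℓ)) := by gcongr
    _ = _ := by ring

section weight

variable {w : EuclideanSpace ℝ (Fin n) → ℝ}

/-- Doubling for weights satisfying the `A_1` inequality. -/
lemma average_double_le {K : ℝ≥0} {a : EuclideanSpace ℝ (Fin n)} {ℓ : ℝ} (hℓ : 0 < ℓ)
    (hK : ∀ᵐ x ∂(volume.restrict (cube a (2 * ℓ))),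
        mass w (cube a (2 * ℓ)) / volume (cube a (2 * ℓ)) ≤ K * ENNReal.ofReal (w x)) :
    mass w (cube a (2 * ℓ)) / volume (cube a (2 * ℓ)) ≤
      K * (mass w (cube a ℓ) / volume (cube a ℓ)) := by
  have hv0 := volume_cube_pos a hℓ
  have hvt := volume_cube_ne_top a ℓ
  rw [← mul_div_assoc, ENNReal.le_div_iff_mul_le (Or.inl hv0) (Or.inl hvt), ← setLIntegral_const,
    mass.eq_def w (cube a ℓ), ← lintegral_const_mul' _ _ ENNReal.coe_ne_top]
  exact lintegral_mono_ae (ae_restrict_of_ae_restrict_of_subset (cube_mono a (by linarith)) hK)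

lemma IsRH.rpow_average_le {σ : ℝ} {c : ℝ≥0} (hw : LocallyIntegrable w volume)
    (hc : ∀ (a : EuclideanSpace ℝ (Fin n)) (ℓ : ℝ), 0 < ℓ →
      ((∫⁻ x in cube a ℓ, ENNReal.ofReal (w x) ^ σ) / volume (cube a ℓ)) ^ (1 / σ)
        ≤ c * (mass w (cube a ℓ) / volume (cube a ℓ)))
    {s : ℝ} (hs : 0 < s) (hsσ : s ≤ σ) {a : EuclideanSpace ℝ (Fin n)} {ℓ : ℝ} (hℓ : 0 < ℓ) :
    ((∫⁻ x in cube a ℓ, ENNReal.ofReal (w x) ^ s) / volume (cube a ℓ)) ^ (1 / s)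
        ≤ c * (mass w (cube a ℓ) / volume (cube a ℓ)) :=
  (WeightedMorrey.rpow_average_le (volume_cube_pos a hℓ) (volume_cube_ne_top a ℓ)
    (aemeasurable_of_locallyIntegrable hw) hs hsσ).trans (hc a ℓ hℓ)

end weight

/-! ### Decay of averages over dyadic dilates. -/

variable {w : EuclideanSpace ℝ (Fin n) → ℝ}

/-- The `A_1` inequality with constant `c` on all cubes. -/
def A1Bound (w : EuclideanSpace ℝ (Fin n) → ℝ) (c : ℝ≥0) : Prop :=
  ∀ (a : EuclideanSpace ℝ (Fin n)) (ℓ : ℝ), 0 < ℓ →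
    ∀ᵐ x ∂(volume.restrict (cube a ℓ)),
      mass w (cube a ℓ) / volume (cube a ℓ) ≤ c * ENNReal.ofReal (w x)

/-- The reverse Hölder inequality with exponent `σ` and constant `c` on all cubes. -/
def RHBound (w : EuclideanSpace ℝ (Fin n) → ℝ) (σ : ℝ) (c : ℝ≥0) : Prop :=
  ∀ (a : EuclideanSpace ℝ (Fin n)) (ℓ : ℝ), 0 < ℓ →
    ((∫⁻ x in cube a ℓ, ENNReal.ofReal (w x) ^ σ) / volume (cube a ℓ)) ^ (1 / σ)
      ≤ c * (mass w (cube a ℓ) / volume (cube a ℓ))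

/-- The average `w(Q) / |Q|`. -/
noncomputable def avg (w : EuclideanSpace ℝ (Fin n) → ℝ) (a : EuclideanSpace ℝ (Fin n)) (ℓ : ℝ) :
    ℝ≥0∞ :=
  mass w (cube a ℓ) / volume (cube a ℓ)

lemma avg_ne_top (hw : LocallyIntegrable w volume) (a : EuclideanSpace ℝ (Fin n)) {ℓ : ℝ}
    (hℓ : 0 < ℓ) : avg w a ℓ ≠ ∞ :=
  ENNReal.div_ne_top (mass_cube_ne_top hw a ℓ) (volume_cube_pos a hℓ)

lemma lintegral_rpow_cube_ne_top (hw : LocallyIntegrable w volume) {σ : ℝ} (hσ : 0 < σ) {c : ℝ≥0}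
    (hR : RHBound w σ c) (a : EuclideanSpace ℝ (Fin n)) {ℓ : ℝ} (hℓ : 0 < ℓ) :
    ∫⁻ x in cube a ℓ, ENNReal.ofReal (w x) ^ σ ≠ ∞ := by
  intro h
  have h1 := hR a ℓ hℓ
  rw [h, ENNReal.top_div_of_ne_top (volume_cube_ne_top a ℓ),
    ENNReal.top_rpow_of_pos (by positivity)] at h1
  exact ENNReal.mul_ne_top ENNReal.coe_ne_top (avg_ne_top hw a hℓ) (top_le_iff.1 h1)

/-- `w ^ σ` satisfies the `A_1` inequality. -/
lemma rpow_average_le_ae {σ : ℝ} (hσ : 0 < σ) {c d : ℝ≥0} (hA : A1Bound w c)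
    (hR : RHBound w σ d) (a : EuclideanSpace ℝ (Fin n)) {ℓ : ℝ} (hℓ : 0 < ℓ) :
    ∀ᵐ x ∂(volume.restrict (cube a ℓ)),
      (∫⁻ y in cube a ℓ, ENNReal.ofReal (w y) ^ σ) / volume (cube a ℓ) ≤
        ((d * c) ^ σ : ℝ≥0) * ENNReal.ofReal (w x) ^ σ := by
  filter_upwards [hA a ℓ hℓ] with x hx
  have h := (hR a ℓ hℓ).trans (mul_le_mul_right hx d)
  rw [← mul_assoc, one_div, ENNReal.rpow_inv_le_iff hσ, ENNReal.mul_rpow_of_nonneg _ _ hσ.le] at h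
  rw [ENNReal.coe_rpow_of_nonneg _ hσ.le, ENNReal.coe_mul]
  exact h

/-- Averages of an `A_1 ∩ RH_σ` weight over concentric dyadic dilations decay at a rate strictly
better than the one given by Hölder's inequality. -/
lemma exists_avg_decay (hn : 0 < n) (hw : LocallyIntegrable w volume) {σ : ℝ} (hσ : 1 ≤ σ)
    {c d : ℝ≥0} (hA : A1Bound w c) (hR : RHBound w σ d) :
    ∃ ρ : ℝ, 0 < ρ ∧ ρ < 2 ^ (n / σ) ∧ ∀ (a : EuclideanSpace ℝ (Fin n)) (ℓ : ℝ), 0 < ℓ → ∀ k : ℕ,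
      avg w a ℓ ≤ ENNReal.ofReal (ρ ^ k) * (d * avg w a (2 ^ k * ℓ)) := by
  have hσ0 : 0 < σ := by linarith
  obtain ⟨θ, hθ0, hθ1, hθ⟩ := exists_reverse_doubling hn
    (g := fun x => ENNReal.ofReal (w x) ^ σ) (K := (d * c) ^ σ)
    -- The side `max ℓ 1` covers `ℓ ≤ 0` too, where the reverse Hölder bound is not available.
    (fun a ℓ => ne_top_of_le_ne_top (lintegral_rpow_cube_ne_top hw hσ0 hR a
        (ℓ := max ℓ 1) (by positivity)) (lintegral_mono_set (cube_mono a (le_max_left _ _))))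
    (fun a ℓ hℓ => rpow_average_le_ae hσ0 hA hR a hℓ)
  have hiter (a : EuclideanSpace ℝ (Fin n)) (ℓ : ℝ) (hℓ : 0 < ℓ) (k : ℕ) :
      ∫⁻ x in cube a ℓ, ENNReal.ofReal (w x) ^ σ ≤
        ENNReal.ofReal (θ ^ k) * ∫⁻ x in cube a (2 ^ k * ℓ), ENNReal.ofReal (w x) ^ σ := by
    induction k with
    | zero => simp
    | succ k ih =>
      refine ih.trans ?_
      rw [pow_succ, ENNReal.ofReal_mul (by positivity), mul_assoc, pow_succ, mul_comm _ (2 : ℝ),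
        mul_assoc (2 : ℝ)]
      gcongr
      exact hθ a _ (by positivity)
  have hρ : 0 < θ * 2 ^ n := by positivity
  -- Each halving of the side shrinks the integral of `w ^ σ` by `θ` and the volume by `2 ^ n`, so
  -- its average grows by at most `θ * 2 ^ n`; the root `1 / σ` passes to averages of `w`.
  refine ⟨(θ * 2 ^ n) ^ (1 / σ), by positivity, ?_, fun a ℓ hℓ k => ?_⟩
  · rw [show (2 : ℝ) ^ (n / σ) = (2 ^ n : ℝ) ^ (1 / σ) by
      rw [← Real.rpow_natCast, ← Real.rpow_mul (by norm_num)]; ring_nf]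
    exact Real.rpow_lt_rpow hρ.le (by nlinarith [pow_pos (show (0:ℝ) < 2 by norm_num) n])
      (by positivity)
  · have h1 := rpow_average_le (volume_cube_pos a hℓ) (volume_cube_ne_top a ℓ)
      (aemeasurable_of_locallyIntegrable hw) one_pos hσ
    simp only [ENNReal.rpow_one, div_one] at h1
    refine h1.trans ?_
    have hv0 := volume_cube_pos a hℓ
    have hvt := volume_cube_ne_top a ℓ
    have h2 : (∫⁻ x in cube a ℓ, ENNReal.ofReal (w x) ^ σ) / volume (cube a ℓ) ≤
        ENNReal.ofReal ((θ * 2 ^ n) ^ k) *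
          ((∫⁻ x in cube a (2 ^ k * ℓ), ENNReal.ofReal (w x) ^ σ)
            / volume (cube a (2 ^ k * ℓ))) := by
      have h2n : ENNReal.ofReal ((2 ^ k) ^ n) ≠ 0 := by
        simp only [ne_eq, ENNReal.ofReal_eq_zero, not_le]; positivity
      rw [ENNReal.div_le_iff hv0 hvt, volume_cube_mul a a (by positivity : (0:ℝ) ≤ 2 ^ k),
        mul_pow, ENNReal.ofReal_mul (by positivity), ← pow_mul, mul_comm n k, pow_mul]
      refine (hiter a ℓ hℓ k).trans (le_of_eq ?_)
      rw [ENNReal.div_eq_inv_mul, ENNReal.mul_inv (Or.inl h2n) (Or.inl ENNReal.ofReal_ne_top)]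
      calc _ = ENNReal.ofReal (θ ^ k) *
            (∫⁻ x in cube a (2 ^ k * ℓ), ENNReal.ofReal (w x) ^ σ) *
            (ENNReal.ofReal ((2 ^ k) ^ n) * (ENNReal.ofReal ((2 ^ k) ^ n))⁻¹) *
            (volume (cube a ℓ) * (volume (cube a ℓ))⁻¹) := by
            rw [ENNReal.mul_inv_cancel h2n ENNReal.ofReal_ne_top, ENNReal.mul_inv_cancel hv0 hvt,
              mul_one, mul_one]
        _ = _ := by ring
    calc _ ≤ _ := ENNReal.rpow_le_rpow h2 (by positivity)
      _ = ENNReal.ofReal (((θ * 2 ^ n) ^ (1 / σ)) ^ k) * _ := by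
        rw [ENNReal.mul_rpow_of_nonneg _ _ (by positivity),
          ENNReal.ofReal_rpow_of_pos (by positivity), Real.rpow_pow_comm hρ.le]
      _ ≤ _ := by
        gcongr
        exact hR a _ (by positivity)

/-! ### Pointwise bounds for the maximal weight. -/

/-- Reverse Hölder turns each `s`-average into an average of `w`, which the pointwise `A_1` bound
controls by `w x`. This is the estimate used near `Q`. -/
lemma maximalWeight_le_ae (hw : LocallyIntegrable w volume) {σ s : ℝ} (hs : 0 < s) (hsσ : s ≤ σ)
    {c d : ℝ≥0} (hA : A1Bound w c) (hR : RHBound w σ d) :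
    ∀ᵐ x, ∀ S : Set (EuclideanSpace ℝ (Fin n)),
      maximalWeight w s S x ≤ d * (ENNReal.ofReal (2 ^ n) * c) * ENNReal.ofReal (w x) := by
  filter_upwards [ae_forall_cube_average_le hA] with x hx S
  rw [maximalWeight, one_div, ENNReal.rpow_inv_le_iff hs, maximal]
  refine iSup_le fun a => iSup_le fun ℓ => iSup_le fun hℓ => iSup_le fun hxa => ?_
  rw [← ENNReal.rpow_inv_le_iff hs, ← one_div, mul_assoc]
  refine le_trans ?_ ((IsRH.rpow_average_le hw hR hs hsσ hℓ).trans
    (mul_le_mul_right (hx a ℓ hℓ hxa) d))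
  gcongr
  exact indicator_le_self _ _ _

/-- Only cubes meeting `Q` contribute, and those reaching `x` are large, so the integral over `Q` is
divided by a large volume. Stating the rate with `s₀` makes the bound uniform in `s ≤ s₀`. -/
lemma maximalWeight_le_of_notMem (hw : LocallyIntegrable w volume) {σ s s₀ : ℝ} (hs : 1 ≤ s)
    (hs₀ : s ≤ s₀) (hsσ : s₀ ≤ σ) {d : ℝ≥0} (hR : RHBound w σ d)
    {a x : EuclideanSpace ℝ (Fin n)} {ℓ : ℝ} (hℓ : 0 < ℓ) {k : ℕ} (hk : 1 ≤ k)
    (hx : x ∉ cube a (2 ^ k * ℓ)) :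
    maximalWeight w s (cube a ℓ) x ≤
      ENNReal.ofReal (4 ^ n * (2 ^ (-(n / s₀))) ^ k) * (d * avg w a ℓ) := by
  have hs0 : 0 < s := by linarith
  rw [maximalWeight, one_div, ENNReal.rpow_inv_le_iff hs0, maximal]
  refine iSup_le fun b => iSup_le fun t => iSup_le fun ht => iSup_le fun hxb => ?_
  rw [← ENNReal.rpow_inv_le_iff hs0, ← one_div]
  by_cases hint : (cube b t ∩ cube a ℓ).Nonempty
  · obtain ⟨y, hyb, hya⟩ := hint
    -- In some coordinate `x` and `y` differ by more than `(2 ^ k - 1) * ℓ / 2`, which is at least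
    -- `2 ^ k * ℓ / 4` because `k ≥ 1`.
    have ht1 : 2 ^ k / 4 * ℓ ≤ t := by
      simp only [cube, mem_ofPred_eq, not_forall, not_le] at hx
      obtain ⟨i, hi⟩ := hx
      have h1 := hxb i
      have h2 := hyb i
      have h3 := hya i
      have h4 := abs_sub_le (x i) (y i) (a i)
      have h5 := abs_sub_le (x i) (b i) (y i)
      rw [abs_sub_comm (b i)] at h5
      have h6 : (2 : ℝ) ≤ 2 ^ k := by
        exact le_self_pow₀ (by norm_num) (by omega)
      nlinarith
    have hvol : ENNReal.ofReal ((2 ^ k / 4) ^ n) * volume (cube a ℓ) ≤ volume (cube b t) := by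
      rw [← volume_cube_mul b a (by positivity), volume_cube, volume_cube]
      gcongr
    have hI : ∫⁻ y in cube b t, (cube a ℓ).indicator (fun y => ENNReal.ofReal (w y) ^ s) y ≤
        ∫⁻ y in cube a ℓ, ENNReal.ofReal (w y) ^ s := by
      rw [← lintegral_indicator (measurableSet_cube a ℓ)]
      exact setLIntegral_le_lintegral _ _
    have hkp : 0 < ((2 : ℝ) ^ k / 4) ^ n := by positivity
    have hreal : ((((2 : ℝ) ^ k / 4) ^ n)⁻¹) ^ (1 / s) ≤ 4 ^ n * (2 ^ (-(n / s₀))) ^ k := by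
      have e : (((2 : ℝ) ^ k / 4) ^ n)⁻¹ = 4 ^ n * 2 ^ (-((k : ℝ) * n)) := by
        rw [Real.rpow_neg (by norm_num), Real.rpow_mul (by norm_num), Real.rpow_natCast,
          Real.rpow_natCast, div_pow, inv_div, div_eq_mul_inv]
      rw [e, Real.mul_rpow (by positivity) (by positivity)]
      have h4 : ((4 : ℝ) ^ n) ^ (1 / s) ≤ 4 ^ n := by
        apply Real.rpow_le_self_of_one_le (one_le_pow₀ (by norm_num))
        rw [div_le_one hs0]; exact hs
      gcongr
      rw [← Real.rpow_natCast _ k, ← Real.rpow_mul (by norm_num), ← Real.rpow_mul (by norm_num)]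
      apply Real.rpow_le_rpow_of_exponent_le (by norm_num)
      have : (n : ℝ) / s₀ ≤ n / s := by gcongr
      have := mul_le_mul_of_nonneg_left this (Nat.cast_nonneg (α := ℝ) k)
      calc _ = -(k * (n / s)) := by ring
        _ ≤ -(k * (n / s₀)) := by linarith
        _ = _ := by ring
    calc _ ≤ ((∫⁻ y in cube a ℓ, ENNReal.ofReal (w y) ^ s) /
          (ENNReal.ofReal ((2 ^ k / 4) ^ n) * volume (cube a ℓ))) ^ (1 / s) := by gcongr
      _ = (ENNReal.ofReal ((((2 : ℝ) ^ k / 4) ^ n)⁻¹) *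
          ((∫⁻ y in cube a ℓ, ENNReal.ofReal (w y) ^ s) / volume (cube a ℓ))) ^ (1 / s) := by
        rw [ENNReal.div_eq_inv_mul, ENNReal.mul_inv (Or.inl (ENNReal.ofReal_pos.2 hkp).ne')
          (Or.inl ENNReal.ofReal_ne_top), ENNReal.ofReal_inv_of_pos hkp, mul_assoc,
          ENNReal.div_eq_inv_mul]
      _ = ENNReal.ofReal (((((2 : ℝ) ^ k / 4) ^ n)⁻¹) ^ (1 / s)) *
          ((∫⁻ y in cube a ℓ, ENNReal.ofReal (w y) ^ s) / volume (cube a ℓ)) ^ (1 / s) := by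
        rw [ENNReal.mul_rpow_of_nonneg _ _ (by positivity),
          ENNReal.ofReal_rpow_of_pos (by positivity)]
      _ ≤ _ := by
        gcongr
        exact IsRH.rpow_average_le hw hR hs0 (hs₀.trans hsσ) hℓ
  · have : ∫⁻ y in cube b t, (cube a ℓ).indicator (fun y => ENNReal.ofReal (w y) ^ s) y = 0 := by
      rw [setLIntegral_congr_fun (g := fun _ => 0) (measurableSet_cube b t), lintegral_zero]
      intro y hy
      exact indicator_of_notMem (fun h => hint ⟨y, hy, h⟩) _
    rw [this, ENNReal.zero_div, ENNReal.zero_rpow_of_pos (by positivity)]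
    exact zero_le

lemma avg_ne_zero (hw : LocallyIntegrable w volume) (hpos : ∀ᵐ x, 0 < w x)
    (a : EuclideanSpace ℝ (Fin n)) {ℓ : ℝ} (hℓ : 0 < ℓ) : avg w a ℓ ≠ 0 :=
  ENNReal.div_ne_zero.2 ⟨mass_cube_ne_zero (aemeasurable_of_locallyIntegrable hw) hpos a hℓ,
    volume_cube_ne_top a ℓ⟩

lemma exists_mem_cube (a x : EuclideanSpace ℝ (Fin n)) {ℓ : ℝ} (hℓ : 0 < ℓ) :
    ∃ k : ℕ, x ∈ cube a (2 ^ (k + 1) * ℓ) := by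
  obtain ⟨k, hk⟩ := pow_unbounded_of_one_lt (‖x - a‖ / ℓ) (by norm_num : (1:ℝ) < 2)
  refine ⟨k, fun i => ?_⟩
  rw [div_lt_iff₀ hℓ] at hk
  have := PiLp.norm_apply_le (x - a) i
  simp only [PiLp.sub_apply, Real.norm_eq_abs] at this
  rw [pow_succ]
  linarith

/-- The pointwise bound of `M(w^s χ_Q)^{1/s}` on the dyadic dilations of `Q`. -/
lemma exists_maximalWeight_le_tsum (hw : LocallyIntegrable w volume) (hpos : ∀ᵐ x, 0 < w x)
    {σ s₀ : ℝ} (hsσ : s₀ ≤ σ) {c d : ℝ≥0} (hA : A1Bound w c) (hR : RHBound w σ d) :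
    ∃ C : ℝ≥0, ∀ s : ℝ, 1 ≤ s → s ≤ s₀ → ∀ (a : EuclideanSpace ℝ (Fin n)) (ℓ : ℝ), 0 < ℓ →
      ∀ᵐ x, maximalWeight w s (cube a ℓ) x ≤
        ∑' k : ℕ, (cube a (2 ^ (k + 1) * ℓ)).indicator (fun x =>
          (C * (ENNReal.ofReal ((2 ^ (-(n / s₀))) ^ k) *
            (avg w a ℓ / avg w a (2 ^ (k + 1) * ℓ)))) * ENNReal.ofReal (w x)) x := by
  set N : ℝ≥0 := 2 ^ n with hN
  have hN' : ENNReal.ofReal (2 ^ n) = N := by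
    rw [ENNReal.ofReal_pow (by norm_num)]; simp [hN]
  have h4' : ENNReal.ofReal (4 ^ n) = ((4 ^ n : ℝ≥0) : ℝ≥0∞) := by
    rw [ENNReal.ofReal_pow (by norm_num)]; simp
  -- The summand `c` serves the points of `2Q`, the summand `4 ^ n` all the others.
  refine ⟨d * N * c * (c + 4 ^ n), fun s hs hs₀ a ℓ hℓ => ?_⟩
  filter_upwards [maximalWeight_le_ae hw (by linarith) (hs₀.trans hsσ) hA hR,
    ae_forall_cube_average_le hA] with x hx hx'
  have hex := exists_mem_cube a x hℓ
  classical
  -- Minimality of `k` puts `x` outside the previous dilate, so the single term `k` of the series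
  -- already suffices.
  obtain ⟨k, hk, hmin⟩ : ∃ k, x ∈ cube a (2 ^ (k + 1) * ℓ) ∧
      ∀ j < k, x ∉ cube a (2 ^ (j + 1) * ℓ) :=
    ⟨Nat.find hex, Nat.find_spec hex, fun j hj => Nat.find_min hex hj⟩
  refine le_trans ?_ (ENNReal.le_tsum k)
  rw [indicator_of_mem hk]
  have hkℓ : 0 < 2 ^ (k + 1) * ℓ := by positivity
  have h0 := avg_ne_zero hw hpos a hkℓ
  have ht := avg_ne_top hw a hkℓ
  rcases Nat.eq_zero_or_pos k with rfl | hk0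
  -- For `k = 0` the far estimate is unavailable; doubling bounds the ratio of averages below.
  · have hd : 1 ≤ c * (avg w a ℓ / avg w a (2 ^ (0 + 1) * ℓ)) := by
      rw [← mul_div_assoc, ENNReal.le_div_iff_mul_le (Or.inl h0) (Or.inl ht), one_mul, zero_add,
        pow_one]
      exact average_double_le hℓ (hA a _ (by positivity))
    calc _ ≤ d * (ENNReal.ofReal (2 ^ n) * c) * ENNReal.ofReal (w x) := hx _
      _ = d * N * c * 1 * ENNReal.ofReal (w x) := by rw [hN']; ring
      _ ≤ d * N * c * (c * (avg w a ℓ / avg w a (2 ^ (0 + 1) * ℓ))) * ENNReal.ofReal (w x) := by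
        gcongr
      _ = ((d * N * c * c : ℝ≥0) * (ENNReal.ofReal ((2 ^ (-(n / s₀))) ^ 0) *
            (avg w a ℓ / avg w a (2 ^ (0 + 1) * ℓ)))) * ENNReal.ofReal (w x) := by
        simp only [pow_zero, ENNReal.ofReal_one, ENNReal.coe_mul]; ring
      _ ≤ _ := by
        gcongr
        exact le_self_add
  · obtain ⟨j, rfl⟩ := Nat.exists_eq_add_of_lt hk0
    simp only [zero_add] at *
    calc _ ≤ _ := maximalWeight_le_of_notMem hw hs hs₀ hsσ hR hℓ (by omega) (hmin j (by omega))
      _ = ENNReal.ofReal (4 ^ n * (2 ^ (-(n / s₀))) ^ (j + 1)) *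
          (d * (avg w a ℓ / avg w a (2 ^ (j + 1 + 1) * ℓ) * avg w a (2 ^ (j + 1 + 1) * ℓ))) := by
        rw [ENNReal.div_mul_cancel h0 ht]
      _ ≤ ENNReal.ofReal (4 ^ n * (2 ^ (-(n / s₀))) ^ (j + 1)) *
          (d * (avg w a ℓ / avg w a (2 ^ (j + 1 + 1) * ℓ) *
            (ENNReal.ofReal (2 ^ n) * c * ENNReal.ofReal (w x)))) := by
        gcongr
        exact hx' a _ hkℓ hk
      _ = ((d * N * c * 4 ^ n : ℝ≥0) * (ENNReal.ofReal ((2 ^ (-(n / s₀))) ^ (j + 1)) *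
            (avg w a ℓ / avg w a (2 ^ (j + 1 + 1) * ℓ)))) * ENNReal.ofReal (w x) := by
        rw [ENNReal.ofReal_mul (by positivity), hN', h4']
        simp only [ENNReal.coe_mul]; ring
      _ ≤ _ := by
        gcongr
        exact le_add_self

/-! ### Geometric summation for both Morrey norms. -/

lemma lintegral_cube_le {p : ℝ} (hp : 1 ≤ p) {t : ℝ} {b J N : ℝ≥0∞} (hb0 : b ≠ 0) (hbt : b ≠ ∞)
    (h : b ^ (-t) * J ^ (1 / p) ≤ N) : J ≤ b ^ (t * p) * N ^ p := by
  have hp0 : 0 < p := by linarith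
  have h1 : J ^ (1 / p) ≤ b ^ t * N := by
    calc J ^ (1 / p) = b ^ t * (b ^ (-t) * J ^ (1 / p)) := by
          rw [← mul_assoc, ← ENNReal.rpow_add _ _ hb0 hbt]; simp
      _ ≤ _ := by gcongr
  rwa [one_div, ENNReal.rpow_inv_le_iff hp0, ENNReal.mul_rpow_of_nonneg _ _ hp0.le,
    ← ENNReal.rpow_mul] at h1

/-- The geometric summation behind the embeddings of both Morrey spaces: here `b a ℓ` is either
`w(Q)` or `|Q|`. -/
lemma exists_weightedLpNorm_le (hw : LocallyIntegrable w volume) (hpos : ∀ᵐ x, 0 < w x)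
    {σ s₀ : ℝ} (hsσ : s₀ ≤ σ) {c d : ℝ≥0} (hA : A1Bound w c) (hR : RHBound w σ d)
    {p t : ℝ} (hp : 1 ≤ p) (b : EuclideanSpace ℝ (Fin n) → ℝ → ℝ≥0∞)
    (hb0 : ∀ a ℓ, 0 < ℓ → b a ℓ ≠ 0) (hbt : ∀ a ℓ, b a ℓ ≠ ∞) {C₁ q : ℝ} (hC₁ : 0 ≤ C₁)
    (hq0 : 0 ≤ q) (hq1 : q < 1)
    (hb : ∀ (a : EuclideanSpace ℝ (Fin n)) (ℓ : ℝ), 0 < ℓ → ∀ k : ℕ,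
      ENNReal.ofReal ((2 ^ (-(n / s₀))) ^ k) * (avg w a ℓ / avg w a (2 ^ (k + 1) * ℓ)) *
        b a (2 ^ (k + 1) * ℓ) ^ (t * p) ≤ ENNReal.ofReal (C₁ * q ^ k) * b a ℓ ^ (t * p)) :
    ∃ C : ℝ≥0, ∀ s : ℝ, 1 ≤ s → s ≤ s₀ → ∀ (a : EuclideanSpace ℝ (Fin n)) (ℓ : ℝ), 0 < ℓ →
      ∀ f : EuclideanSpace ℝ (Fin n) →ₘ[volume] ℂ,
        weightedLpNorm p (maximalWeight w s (cube a ℓ)) univ f ≤ C * b a ℓ ^ t *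
          ⨆ (a : EuclideanSpace ℝ (Fin n)) (ℓ : ℝ) (_ : 0 < ℓ), b a ℓ ^ (-t) *
            weightedLpNorm p (fun x => ENNReal.ofReal (w x)) (cube a ℓ) f := by
  have hp0 : 0 < p := by linarith
  obtain ⟨C, hC⟩ := exists_maximalWeight_le_tsum hw hpos hsσ hA hR
  have hS : ∑' k : ℕ, ENNReal.ofReal (C₁ * q ^ k) = ENNReal.ofReal (C₁ * (1 - q)⁻¹) := by
    rw [← tsum_geometric_of_lt_one hq0 hq1, ← tsum_mul_left, ENNReal.ofReal_tsum_of_nonneg]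
    · intro k; positivity
    · exact (summable_geometric_of_lt_one hq0 hq1).mul_left _
  -- The sum of the geometric series, with the root `1 / p` from the norm.
  refine ⟨(C * Real.toNNReal (C₁ * (1 - q)⁻¹)) ^ (1 / p), fun s hs hs₀ a ℓ hℓ f => ?_⟩
  set N := ⨆ (a : EuclideanSpace ℝ (Fin n)) (ℓ : ℝ) (_ : 0 < ℓ), b a ℓ ^ (-t) *
            weightedLpNorm p (fun x => ENNReal.ofReal (w x)) (cube a ℓ) f with hN
  have hJ (ℓ : ℝ) (hℓ : 0 < ℓ) :
      ∫⁻ x in cube a ℓ, ‖f x‖ₑ ^ p * ENNReal.ofReal (w x) ≤ b a ℓ ^ (t * p) * N ^ p := by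
    apply lintegral_cube_le hp (hb0 a ℓ hℓ) (hbt a ℓ)
    exact le_iSup_of_le a (le_iSup_of_le ℓ (le_iSup_of_le hℓ le_rfl))
  set T : ℕ → ℝ≥0∞ := fun k => ENNReal.ofReal ((2 ^ (-(n / s₀))) ^ k) *
            (avg w a ℓ / avg w a (2 ^ (k + 1) * ℓ)) with hT
  have hTt (k : ℕ) : (C : ℝ≥0∞) * T k ≠ ∞ := by
    refine ENNReal.mul_ne_top ENNReal.coe_ne_top (ENNReal.mul_ne_top ENNReal.ofReal_ne_top
      (ENNReal.div_ne_top (avg_ne_top hw a hℓ) (avg_ne_zero hw hpos a (by positivity))))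
  have hmeas : AEMeasurable (fun x => ‖f x‖ₑ ^ p * ENNReal.ofReal (w x)) volume :=
    (f.aestronglyMeasurable.enorm.pow_const p).mul (aemeasurable_of_locallyIntegrable hw)
  have hint : ∫⁻ x in univ, ‖f x‖ₑ ^ p * maximalWeight w s (cube a ℓ) x ≤
      (C * Real.toNNReal (C₁ * (1 - q)⁻¹) : ℝ≥0) * b a ℓ ^ (t * p) * N ^ p := by
    rw [Measure.restrict_univ]
    calc ∫⁻ x, ‖f x‖ₑ ^ p * maximalWeight w s (cube a ℓ) x
        ≤ ∫⁻ x, ∑' k : ℕ, (cube a (2 ^ (k + 1) * ℓ)).indicator (fun x =>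
          (C * T k) * (‖f x‖ₑ ^ p * ENNReal.ofReal (w x))) x := by
          refine lintegral_mono_ae ?_
          filter_upwards [hC s hs hs₀ a ℓ hℓ] with x hx
          refine (mul_le_mul_right hx _).trans (le_of_eq ?_)
          rw [← ENNReal.tsum_mul_left]
          refine tsum_congr fun k => ?_
          by_cases hxk : x ∈ cube a (2 ^ (k + 1) * ℓ)
          · rw [indicator_of_mem hxk, indicator_of_mem hxk]; ring
          · rw [indicator_of_notMem hxk, indicator_of_notMem hxk, mul_zero]
      _ = ∑' k : ℕ, (C * T k) * ∫⁻ x in cube a (2 ^ (k + 1) * ℓ),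
            ‖f x‖ₑ ^ p * ENNReal.ofReal (w x) := by
          rw [lintegral_tsum fun k => (hmeas.const_mul _).indicator (measurableSet_cube _ _)]
          refine tsum_congr fun k => ?_
          rw [lintegral_indicator (measurableSet_cube _ _), lintegral_const_mul' _ _ (hTt k)]
      _ ≤ ∑' k : ℕ, ENNReal.ofReal (C₁ * q ^ k) * (C * b a ℓ ^ (t * p) * N ^ p) := by
          refine ENNReal.tsum_le_tsum fun k => ?_
          calc _ ≤ (C * T k) * (b a (2 ^ (k + 1) * ℓ) ^ (t * p) * N ^ p) := by
                gcongr
                exact hJ _ (by positivity)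
            _ = (T k * b a (2 ^ (k + 1) * ℓ) ^ (t * p)) * (C * N ^ p) := by ring
            _ ≤ (ENNReal.ofReal (C₁ * q ^ k) * b a ℓ ^ (t * p)) * (C * N ^ p) := by
                exact mul_le_mul_left (hb a ℓ hℓ k) _
            _ = _ := by ring
      _ = _ := by
          rw [ENNReal.tsum_mul_right, hS, ENNReal.coe_mul, ENNReal.ofReal]
          ring
  calc _ ≤ _ := ENNReal.rpow_le_rpow hint (by positivity)
    _ = _ := by
      rw [ENNReal.mul_rpow_of_nonneg _ _ (by positivity),
        ENNReal.mul_rpow_of_nonneg _ _ (by positivity), ← ENNReal.rpow_mul, ← ENNReal.rpow_mul,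
        mul_assoc t, mul_one_div_cancel hp0.ne', mul_one, ENNReal.rpow_one,
        ENNReal.coe_rpow_of_nonneg _ (by positivity)]

/-! ### The two geometric ratios. -/

/-- The common ratio for `L^r_p(w)`, with `e = rp/n`. -/
noncomputable def morreyRatio (n : ℕ) (ρ e s : ℝ) : ℝ :=
  2 ^ (-(n / s)) * (2 ^ n * (2 ^ n / ρ) ^ e)

/-- The common ratio for `L^r_p(λ, w)`, with `e = rp/n`. -/
noncomputable def morreyLebesgueRatio (n : ℕ) (ρ e s : ℝ) : ℝ :=
  2 ^ (-(n / s)) * (ρ * (2 ^ n) ^ (1 + e))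

/-- In the application `D = 2 ^ n`, `L = |Q|`, and `α₀`, `α₁` are the averages over `Q` and `2 ^ (k
+ 1) Q`. Decay bounds the mass of the dilate from below; since `e ≤ 0`, its power `e` is bounded
from above. -/
lemma rpow_mul_le_of_decay {α₀ α₁ ρ d D L x e : ℝ} (h₀ : 0 < α₀) (h₁ : 0 < α₁) (hρ : 0 < ρ)
    (hd : 0 < d) (hD : 0 < D) (hL : 0 < L) (hx : 0 < x) (he : e ≤ 0) {k : ℕ}
    (h : α₀ ≤ ρ ^ (k + 1) * (d * α₁)) :
    x ^ k * (α₀ / α₁) * (α₁ * (D ^ (k + 1) * L)) ^ (1 + e) ≤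
      (D * (D / ρ) ^ e * (1 / d) ^ e) * (x * (D * (D / ρ) ^ e)) ^ k * (α₀ * L) ^ (1 + e) := by
  have hDρ : 0 < D / ρ := by positivity
  have hle : (1 / d) * (D / ρ) ^ (k + 1) * (α₀ * L) ≤ α₁ * (D ^ (k + 1) * L) := by
    have : α₀ * ((1 / d) * (D / ρ) ^ (k + 1) * L) ≤
        ρ ^ (k + 1) * (d * α₁) * ((1 / d) * (D / ρ) ^ (k + 1) * L) := by gcongr
    refine (le_of_eq (by ring)).trans (this.trans (le_of_eq ?_))
    rw [div_pow]; field_simp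
  have hmono := Real.rpow_le_rpow_of_nonpos (by positivity) hle he
  rw [Real.mul_rpow (x := 1 / d * (D / ρ) ^ (k + 1)) (by positivity) (by positivity),
    Real.mul_rpow (x := 1 / d) (by positivity) (by positivity),
    ← Real.rpow_pow_comm hDρ.le] at hmono
  rw [Real.rpow_add (by positivity), Real.rpow_one, Real.rpow_add (by positivity) 1 e,
    Real.rpow_one]
  calc _ = x ^ k * (α₀ * D ^ (k + 1) * L) * (α₁ * (D ^ (k + 1) * L)) ^ e := by field_simp
    _ ≤ x ^ k * (α₀ * D ^ (k + 1) * L) *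
        ((1 / d) ^ e * ((D / ρ) ^ e) ^ (k + 1) * (α₀ * L) ^ e) := by gcongr
    _ = _ := by ring

/-- The Lebesgue counterpart: decay is applied only to the ratio of averages, so no sign of `e` is
needed. -/
lemma rpow_mul_le_of_decay' {α₀ α₁ ρ d D L x e : ℝ} (h₁ : 0 < α₁) (hD : 0 < D) (hL : 0 < L)
    (hx : 0 < x) {k : ℕ} (h : α₀ ≤ ρ ^ (k + 1) * (d * α₁)) :
    x ^ k * (α₀ / α₁) * (D ^ (k + 1) * L) ^ (1 + e) ≤
      (d * ρ * D ^ (1 + e)) * (x * (ρ * D ^ (1 + e))) ^ k * L ^ (1 + e) := by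
  have h' : α₀ / α₁ ≤ ρ ^ (k + 1) * d := by
    rw [div_le_iff₀ h₁]; linarith
  rw [Real.mul_rpow (by positivity) (by positivity), ← Real.rpow_pow_comm hD.le]
  calc _ ≤ x ^ k * (ρ ^ (k + 1) * d) * ((D ^ (1 + e)) ^ (k + 1) * L ^ (1 + e)) := by gcongr
    _ = _ := by ring

lemma avg_eq_ofReal (hw : LocallyIntegrable w volume) (hpos : ∀ᵐ x, 0 < w x)
    (a : EuclideanSpace ℝ (Fin n)) {ℓ : ℝ} (hℓ : 0 < ℓ) :
    ∃ α : ℝ, 0 < α ∧ avg w a ℓ = ENNReal.ofReal α ∧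
      mass w (cube a ℓ) = ENNReal.ofReal (α * ℓ ^ n) := by
  have ht := avg_ne_top hw a hℓ
  have h0 := avg_ne_zero hw hpos a hℓ
  refine ⟨(avg w a ℓ).toReal, ENNReal.toReal_pos h0 ht, (ENNReal.ofReal_toReal ht).symm, ?_⟩
  rw [ENNReal.ofReal_mul ENNReal.toReal_nonneg, ENNReal.ofReal_toReal ht, avg,
    ENNReal.ofReal_pow hℓ.le, ← volume_cube a, ENNReal.div_mul_cancel (volume_cube_pos a hℓ)
    (volume_cube_ne_top a ℓ)]

lemma exists_maximalWeight_norm_le_morreyNorm (hn : 0 < n) (hw : LocallyIntegrable w volume)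
    (hpos : ∀ᵐ x, 0 < w x) {σ s₀ : ℝ} (hsσ : s₀ ≤ σ) {c d : ℝ≥0} (hd : 0 < d) (hA : A1Bound w c)
    (hR : RHBound w σ d) {ρ : ℝ} (hρ : 0 < ρ)
    (hdecay : ∀ (a : EuclideanSpace ℝ (Fin n)) (ℓ : ℝ), 0 < ℓ → ∀ k : ℕ,
      avg w a ℓ ≤ ENNReal.ofReal (ρ ^ k) * (d * avg w a (2 ^ k * ℓ)))
    {p r : ℝ} (hp : 1 ≤ p) (hr : r ≤ 0) (hq : morreyRatio n ρ (r * p / n) s₀ < 1) :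
    ∃ C : ℝ≥0, ∀ s : ℝ, 1 ≤ s → s ≤ s₀ → ∀ (a : EuclideanSpace ℝ (Fin n)) (ℓ : ℝ), 0 < ℓ →
      ∀ f : EuclideanSpace ℝ (Fin n) →ₘ[volume] ℂ,
        weightedLpNorm p (maximalWeight w s (cube a ℓ)) univ f ≤
          C * mass w (cube a ℓ) ^ (1 / p + r / n) * morreyNorm p r w f := by
  have hp0 : 0 < p := by linarith
  have he : (1 / p + r / n) * p = 1 + r * p / n := by field_simp
  have he0 : r * p / n ≤ 0 := div_nonpos_of_nonpos_of_nonneg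
    (mul_nonpos_of_nonpos_of_nonneg hr hp0.le) (Nat.cast_nonneg n)
  have hd' : 0 < (d : ℝ) := hd
  refine exists_weightedLpNorm_le hw hpos hsσ hA hR hp (fun a ℓ => mass w (cube a ℓ))
    (fun a ℓ hℓ => mass_cube_ne_zero (aemeasurable_of_locallyIntegrable hw) hpos a hℓ)
    (fun a ℓ => mass_cube_ne_top hw a ℓ)
    (C₁ := 2 ^ n * (2 ^ n / ρ) ^ (r * p / n) * (1 / (d : ℝ)) ^ (r * p / n))
    (by positivity) (q := morreyRatio n ρ (r * p / n) s₀) (by unfold morreyRatio; positivity) hq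
    fun a ℓ hℓ k => ?_
  have hkℓ : 0 < 2 ^ (k + 1) * ℓ := by positivity
  obtain ⟨α₀, h₀, ha₀, hm₀⟩ := avg_eq_ofReal hw hpos a hℓ
  obtain ⟨α₁, h₁, ha₁, hm₁⟩ := avg_eq_ofReal hw hpos a hkℓ
  have hdk := hdecay a ℓ hℓ (k + 1)
  rw [ha₀, ha₁, ← ENNReal.ofReal_coe_nnreal, ← ENNReal.ofReal_mul hd'.le,
    ← ENNReal.ofReal_mul (by positivity), ENNReal.ofReal_le_ofReal_iff (by positivity)] at hdk
  rw [he, ha₀, ha₁, hm₀, hm₁, ← ENNReal.ofReal_div_of_pos h₁,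
    ENNReal.ofReal_rpow_of_pos (by positivity), ENNReal.ofReal_rpow_of_pos (by positivity),
    ← ENNReal.ofReal_mul (by positivity), ← ENNReal.ofReal_mul (by positivity),
    ← ENNReal.ofReal_mul (by unfold morreyRatio; positivity)]
  apply ENNReal.ofReal_le_ofReal
  have h := rpow_mul_le_of_decay (L := ℓ ^ n) (D := 2 ^ n) (x := 2 ^ (-(n / s₀))) h₀ h₁ hρ hd'
    (by positivity) (by positivity) (by positivity) he0 hdk
  rwa [← pow_mul, mul_comm n, pow_mul, ← mul_pow] at h

lemma exists_maximalWeight_norm_le_morreyLebesgueNorm (hn : 0 < n)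
    (hw : LocallyIntegrable w volume)
    (hpos : ∀ᵐ x, 0 < w x) {σ s₀ : ℝ} (hsσ : s₀ ≤ σ) {c d : ℝ≥0} (hA : A1Bound w c)
    (hR : RHBound w σ d) {ρ : ℝ} (hρ : 0 < ρ)
    (hdecay : ∀ (a : EuclideanSpace ℝ (Fin n)) (ℓ : ℝ), 0 < ℓ → ∀ k : ℕ,
      avg w a ℓ ≤ ENNReal.ofReal (ρ ^ k) * (d * avg w a (2 ^ k * ℓ)))
    {p r : ℝ} (hp : 1 ≤ p) (hq : morreyLebesgueRatio n ρ (r * p / n) s₀ < 1) :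
    ∃ C : ℝ≥0, ∀ s : ℝ, 1 ≤ s → s ≤ s₀ → ∀ (a : EuclideanSpace ℝ (Fin n)) (ℓ : ℝ), 0 < ℓ →
      ∀ f : EuclideanSpace ℝ (Fin n) →ₘ[volume] ℂ,
        weightedLpNorm p (maximalWeight w s (cube a ℓ)) univ f ≤
          C * volume (cube a ℓ) ^ (1 / p + r / n) * morreyLebesgueNorm p r w f := by
  have hp0 : 0 < p := by linarith
  have he : (1 / p + r / n) * p = 1 + r * p / n := by field_simp
  refine exists_weightedLpNorm_le hw hpos hsσ hA hR hp (fun a ℓ => volume (cube a ℓ))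
    (fun a ℓ hℓ => volume_cube_pos a hℓ) (fun a ℓ => volume_cube_ne_top a ℓ)
    (C₁ := d * ρ * (2 ^ n) ^ (1 + r * p / n))
    (by positivity) (q := morreyLebesgueRatio n ρ (r * p / n) s₀)
    (by unfold morreyLebesgueRatio; positivity) hq fun a ℓ hℓ k => ?_
  have hkℓ : 0 < 2 ^ (k + 1) * ℓ := by positivity
  obtain ⟨α₀, h₀, ha₀, -⟩ := avg_eq_ofReal hw hpos a hℓ
  obtain ⟨α₁, h₁, ha₁, -⟩ := avg_eq_ofReal hw hpos a hkℓ
  have hdk := hdecay a ℓ hℓ (k + 1)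
  rw [ha₀, ha₁, ← ENNReal.ofReal_coe_nnreal, ← ENNReal.ofReal_mul (by positivity),
    ← ENNReal.ofReal_mul (by positivity), ENNReal.ofReal_le_ofReal_iff (by positivity)] at hdk
  rw [he, ha₀, ha₁, volume_cube, volume_cube, ← ENNReal.ofReal_pow hkℓ.le,
    ← ENNReal.ofReal_pow hℓ.le, ← ENNReal.ofReal_div_of_pos h₁,
    ENNReal.ofReal_rpow_of_pos (by positivity), ENNReal.ofReal_rpow_of_pos (by positivity),
    ← ENNReal.ofReal_mul (by positivity), ← ENNReal.ofReal_mul (by positivity),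
    ← ENNReal.ofReal_mul (by unfold morreyLebesgueRatio; positivity)]
  apply ENNReal.ofReal_le_ofReal
  have h := rpow_mul_le_of_decay' (L := ℓ ^ n) (D := 2 ^ n) (x := 2 ^ (-(n / s₀)))
    (e := r * p / n) h₁ (by positivity) (by positivity) (by positivity) hdk
  rwa [← pow_mul, mul_comm n, pow_mul, ← mul_pow] at h

/-! ### The ratios are below 1, also at the endpoints. -/

/-- Replacing `ρ` by `2 ^ (n / σ)` gives a power of 2 whose exponent is nonpositive exactly under
(i). Strictness comes from `ρ < 2 ^ (n / σ)` together with `r < 0`. -/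
lemma morreyRatio_lt_one (hn : 0 < n) {p ν σ r ρ : ℝ} (hp : 1 ≤ p) (hν : 1 ≤ ν) (hσ : ν < σ)
    (hr0 : r < 0) (hρ : 0 < ρ) (hρσ : ρ < 2 ^ (n / σ))
    (hr : r ≤ -(n * (σ / (σ - 1)) * (1 - 1 / ν) / p)) :
    morreyRatio n ρ (r * p / n) ν < 1 := by
  have hp0 : 0 < p := by linarith
  have hn' : 0 < (n : ℝ) := by exact_mod_cast hn
  have he0 : r * p / n < 0 := div_neg_of_neg_of_pos (mul_neg_of_neg_of_pos hr0 hp0) hn'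
  have hσ1 : 0 < σ - 1 := by linarith
  have hσ0 : 0 < σ := by linarith
  have hν0 : 0 < ν := by linarith
  have h2 : (2 : ℝ) ^ (n - n / σ) < 2 ^ n / ρ := by
    rw [Real.rpow_sub (by norm_num), Real.rpow_natCast]
    gcongr
  have h3 := Real.rpow_lt_rpow_of_neg (by positivity) h2 he0
  rw [← Real.rpow_mul (by norm_num)] at h3
  have hexp : -(n / ν) + (n + (n - n / σ) * (r * p / n)) ≤ 0 := by
    have h4 : (n - n / σ) * (r * p / n) = (1 - 1 / σ) * p * r := by field_simp
    have h5 : 0 ≤ (1 - 1 / σ) * p := by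
      have : 1 / σ ≤ 1 := by rw [div_le_one hσ0]; linarith
      exact mul_nonneg (by linarith) hp0.le
    rw [h4]
    have h6 := mul_le_mul_of_nonneg_left hr h5
    have h7 : (1 - 1 / σ) * p * -(n * (σ / (σ - 1)) * (1 - 1 / ν) / p) = -(n * (1 - 1 / ν)) := by
      field_simp
    have h8 : (n : ℝ) / ν = n * (1 / ν) := by ring
    rw [h7] at h6
    rw [h8]
    linarith
  calc morreyRatio n ρ (r * p / n) ν
      < 2 ^ (-(n / ν)) * (2 ^ n * 2 ^ ((n - n / σ) * (r * p / n))) := by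
        unfold morreyRatio; gcongr
    _ = 2 ^ (-(n / ν) + (n + (n - n / σ) * (r * p / n))) := by
        rw [Real.rpow_add (by norm_num), Real.rpow_add (by norm_num), Real.rpow_natCast]
    _ ≤ 1 := Real.rpow_le_one_of_one_le_of_nonpos (by norm_num) hexp

lemma morreyLebesgueRatio_lt_one (hn : 0 < n) {p ν σ r ρ : ℝ} (hp : 1 ≤ p)
    (hρσ : ρ < 2 ^ (n / σ)) (hr : r ≤ -(n * (1 / σ + (1 - 1 / ν)) / p)) :
    morreyLebesgueRatio n ρ (r * p / n) ν < 1 := by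
  have hp0 : 0 < p := by linarith
  have hn' : 0 < (n : ℝ) := by exact_mod_cast hn
  have hexp : -(n / ν) + (n / σ + n * (1 + r * p / n)) ≤ 0 := by
    have h6 := mul_le_mul_of_nonneg_right hr hp0.le
    have h7 : -(n * (1 / σ + (1 - 1 / ν)) / p) * p = -(n / σ + n - n / ν) := by
      rw [neg_mul, div_mul_cancel₀ _ hp0.ne']; ring
    have h8 : n * (1 + r * p / n) = n + r * p := by field_simp
    rw [h7] at h6
    rw [h8]
    linarith
  calc morreyLebesgueRatio n ρ (r * p / n) ν
      < 2 ^ (-(n / ν)) * (2 ^ (n / σ) * (2 ^ n) ^ (1 + r * p / n)) := by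
        unfold morreyLebesgueRatio; gcongr
    _ = 2 ^ (-(n / ν) + (n / σ + n * (1 + r * p / n))) := by
        rw [Real.rpow_add (x := 2) (by norm_num) (-(n / ν)),
          Real.rpow_add (x := 2) (by norm_num) (n / σ),
          Real.rpow_mul (by norm_num), Real.rpow_natCast]
    _ ≤ 1 := Real.rpow_le_one_of_one_le_of_nonpos (by norm_num) hexp

/-- Continuity in `s` preserves a strict inequality just to the right of `ν`. Keeping the conditions
as implications yields one `s₀` for both spaces. -/
lemma exists_exponent {ν σ ρ e : ℝ} (hν : 0 < ν) (hσ : ν < σ) {P P' : Prop}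
    (h : P → morreyRatio n ρ e ν < 1) (h' : P' → morreyLebesgueRatio n ρ e ν < 1) :
    ∃ s₀, ν < s₀ ∧ s₀ ≤ σ ∧ (P → morreyRatio n ρ e s₀ < 1) ∧
      (P' → morreyLebesgueRatio n ρ e s₀ < 1) := by
  have hc : ContinuousAt (fun s : ℝ => (2 : ℝ) ^ (-(n / s))) ν :=
    ContinuousAt.rpow continuousAt_const
      (continuousAt_const.div continuousAt_id hν.ne').neg (Or.inl (by norm_num))
  have h1 : ∀ᶠ s in nhdsWithin ν (Ioi ν), P → morreyRatio n ρ e s < 1 := by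
    by_cases hP : P
    · exact (((hc.mul continuousAt_const).eventually_lt_const (h hP)).filter_mono
        nhdsWithin_le_nhds).mono fun s hs _ => hs
    · exact Filter.Eventually.of_forall fun s hp => absurd hp hP
  have h2 : ∀ᶠ s in nhdsWithin ν (Ioi ν), P' → morreyLebesgueRatio n ρ e s < 1 := by
    by_cases hP : P'
    · exact (((hc.mul continuousAt_const).eventually_lt_const (h' hP)).filter_mono
        nhdsWithin_le_nhds).mono fun s hs _ => hs
    · exact Filter.Eventually.of_forall fun s hp => absurd hp hP
  obtain ⟨s, hs⟩ := (h1.and (h2.and (Ioo_mem_nhdsGT hσ))).exists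
  exact ⟨s, hs.2.2.1, hs.2.2.2.le, hs.1, hs.2.1⟩

/-! ### Comparison with the power weight, and conclusion. -/

lemma exists_powerWeight_le (hw : LocallyIntegrable w volume) (hpos : ∀ᵐ x, 0 < w x) {σ s : ℝ}
    (hs : 0 < s) (hsσ : s ≤ σ) {d : ℝ≥0} (hR : RHBound w σ d) :
    ∃ κ : ℝ≥0, ∀ x, powerWeight (n / s) x ≤ κ * maximalWeight w s (cube 0 2) x := by
  have h2 : (0 : ℝ) < 2 := by norm_num
  set I := ∫⁻ y in cube (n := n) 0 2, ENNReal.ofReal (w y) ^ s with hI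
  have hIt : I ≠ ∞ := by
    intro h
    have h1 := IsRH.rpow_average_le hw hR hs hsσ (a := 0) h2
    rw [← hI, h, ENNReal.top_div_of_ne_top (volume_cube_ne_top 0 2),
      ENNReal.top_rpow_of_pos (by positivity)] at h1
    exact ENNReal.mul_ne_top ENNReal.coe_ne_top (avg_ne_top hw 0 h2) (top_le_iff.1 h1)
  have hI0 : I ≠ 0 := by
    intro h
    rw [hI, lintegral_eq_zero_iff'
      ((aemeasurable_of_locallyIntegrable hw).pow_const s).restrict] at h
    refine mass_cube_ne_zero (aemeasurable_of_locallyIntegrable hw) hpos 0 h2 ?_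
    rw [mass, lintegral_eq_zero_iff' (aemeasurable_of_locallyIntegrable hw).restrict]
    filter_upwards [h] with x hx
    exact (ENNReal.rpow_eq_zero_iff_of_pos hs).1 hx
  have hJ0 : I ^ (1 / s) ≠ 0 := fun h =>
    hI0 ((ENNReal.rpow_eq_zero_iff_of_pos (by positivity)).1 h)
  have hJt : I ^ (1 / s) ≠ ∞ := ENNReal.rpow_ne_top_of_nonneg (by positivity) hIt
  set κ : ℝ≥0∞ := ENNReal.ofReal (2 ^ (n / s)) * (I ^ (1 / s))⁻¹ with hκ
  have hκt : κ ≠ ∞ := ENNReal.mul_ne_top ENNReal.ofReal_ne_top (ENNReal.inv_ne_top.2 hJ0)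
  refine ⟨κ.toNNReal, fun x => ?_⟩
  rw [ENNReal.coe_toNNReal hκt]
  -- The cube of side `t` about 0 contains both `x` and the cube of side 2, and `t ^ (-(n / s))` is
  -- a multiple of the power weight.
  set t : ℝ := 2 * (1 + ‖x‖) with ht
  have hx0 : 0 ≤ ‖x‖ := norm_nonneg x
  have ht0 : 0 < t := by positivity
  have hmem : x ∈ cube 0 t := by
    intro i
    have := PiLp.norm_apply_le x i
    rw [Real.norm_eq_abs] at this
    simp only [PiLp.zero_apply, sub_zero]
    linarith
  have hsub : cube (n := n) 0 2 ⊆ cube 0 t := cube_mono 0 (by linarith)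
  have hM : I / volume (cube (n := n) 0 t) ≤
      maximal ((cube 0 2).indicator fun y => ENNReal.ofReal (w y) ^ s) x := by
    refine le_iSup_of_le 0 (le_iSup_of_le t (le_iSup_of_le ht0 (le_iSup_of_le hmem ?_)))
    gcongr
    rw [setLIntegral_indicator (measurableSet_cube 0 2), inter_eq_left.2 hsub]
  have hM' := ENNReal.rpow_le_rpow hM (z := 1 / s) (by positivity)
  rw [ENNReal.div_rpow_of_nonneg _ _ (by positivity), volume_cube, ← ENNReal.ofReal_pow ht0.le,
    ENNReal.ofReal_rpow_of_pos (by positivity)] at hM'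
  calc powerWeight (n / s) x
      = ENNReal.ofReal (2 ^ (n / s)) * (ENNReal.ofReal ((t ^ n) ^ (1 / s)))⁻¹ := by
        rw [powerWeight, ← ENNReal.ofReal_inv_of_pos (by positivity),
          ← ENNReal.ofReal_mul (by positivity), ← Real.rpow_natCast, ← Real.rpow_mul ht0.le,
          mul_one_div, ht, Real.mul_rpow (by norm_num) (by positivity), mul_inv, ← mul_assoc,
          mul_inv_cancel₀ (by positivity), one_mul, Real.rpow_neg (by positivity)]
    _ = κ * (I ^ (1 / s) / ENNReal.ofReal ((t ^ n) ^ (1 / s))) := by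
        rw [hκ, ENNReal.div_eq_inv_mul]
        calc _ = ENNReal.ofReal (2 ^ (n / s)) * (ENNReal.ofReal ((t ^ n) ^ (1 / s)))⁻¹ *
              ((I ^ (1 / s))⁻¹ * I ^ (1 / s)) := by
              rw [ENNReal.inv_mul_cancel hJ0 hJt, mul_one]
          _ = _ := by ring
    _ ≤ _ := by
        gcongr
        exact hM'

lemma weightedLpNorm_le_of_le {p : ℝ} (hp : 1 ≤ p) {v v' : EuclideanSpace ℝ (Fin n) → ℝ≥0∞}
    {κ : ℝ≥0} (h : ∀ x, v x ≤ κ * v' x) (f : EuclideanSpace ℝ (Fin n) →ₘ[volume] ℂ) :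
    weightedLpNorm p v univ f ≤ (κ ^ (1 / p) : ℝ≥0) * weightedLpNorm p v' univ f := by
  have hp0 : 0 < p := by linarith
  rw [weightedLpNorm, weightedLpNorm, ENNReal.coe_rpow_of_nonneg _ (by positivity),
    ← ENNReal.mul_rpow_of_nonneg _ _ (by positivity),
    ← lintegral_const_mul' _ _ ENNReal.coe_ne_top]
  refine ENNReal.rpow_le_rpow (lintegral_mono fun x => ?_) (by positivity)
  calc _ ≤ ‖f x‖ₑ ^ p * (κ * v' x) := by gcongr; exact h x
    _ = _ := by ring

end WeightedMorrey

theorem mainTheorem8 (n : ℕ) (hn : 0 < n) (p ν σ : ℝ) (hp : 1 ≤ p) (hν : 1 ≤ ν) (hσ : ν < σ)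
    (w : EuclideanSpace ℝ (Fin n) → ℝ) (hA : WeightedMorrey.IsA1 w)
    (hRH : WeightedMorrey.IsRH σ w)
    (r : ℝ) (hr : -(n / p) ≤ r) (hr0 : r < 0) :
    (∃ s₀ : ℝ, ν < s₀ ∧
      (r ≤ -(n * (σ / (σ - 1)) * (1 - 1 / ν) / p) →
        ∃ c : ℝ≥0, ∀ s : ℝ, ν < s → s ≤ s₀ →
          ∀ (a : EuclideanSpace ℝ (Fin n)) (ℓ : ℝ), 0 < ℓ →
            WeightedMorrey.MorreyEmbeds p r w
              (WeightedMorrey.maximalWeight w s (WeightedMorrey.cube a ℓ))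
              (c * WeightedMorrey.mass w (WeightedMorrey.cube a ℓ) ^ (1 / p + r / n))) ∧
      (r ≤ -(n * (1 / σ + (1 - 1 / ν)) / p) →
        ∃ c : ℝ≥0, ∀ s : ℝ, ν < s → s ≤ s₀ →
          ∀ (a : EuclideanSpace ℝ (Fin n)) (ℓ : ℝ), 0 < ℓ →
            WeightedMorrey.MorreyLebesgueEmbeds p r w
              (WeightedMorrey.maximalWeight w s (WeightedMorrey.cube a ℓ))
              (c * volume (WeightedMorrey.cube a ℓ) ^ (1 / p + r / n)))) ∧
    (∃ α : ℝ, 0 < α ∧ α < n / ν ∧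
      (r ≤ -(n * (σ / (σ - 1)) * (1 - 1 / ν) / p) →
        ∃ c : ℝ≥0, WeightedMorrey.MorreyEmbeds p r w (WeightedMorrey.powerWeight α) c) ∧
      (r ≤ -(n * (1 / σ + (1 - 1 / ν)) / p) →
        ∃ c : ℝ≥0, WeightedMorrey.MorreyLebesgueEmbeds p r w
          (WeightedMorrey.powerWeight α) c)) := by
  open WeightedMorrey in
  have hw := hA.locallyIntegrable
  have hpos := hA.pos
  have hn' : 0 < (n : ℝ) := by exact_mod_cast hn
  have hν0 : 0 < ν := by linarith
  have hp0 : 0 < p := by linarith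
  -- The lower bound on `r` makes this exponent nonnegative, so the powers of mass and volume in the
  -- constants are finite.
  have ht : 0 ≤ 1 / p + r / n := by
    have := div_le_div_of_nonneg_right hr hn'.le
    have h1 : -((n : ℝ) / p) / n = -(1 / p) := by field_simp
    linarith
  obtain ⟨c, hc⟩ : ∃ c, A1Bound w c := hA.bound
  obtain ⟨d, hd0, hd⟩ : ∃ d, 0 < d ∧ RHBound w σ d := by
    obtain ⟨d, hd⟩ := hRH.bound
    -- The constant is enlarged to be positive, as `1 / d` is raised to a negative power later.
    refine ⟨d + 1, by positivity, fun a ℓ hℓ => (hd a ℓ hℓ).trans ?_⟩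
    gcongr
    exact le_self_add
  obtain ⟨ρ, hρ, hρσ, hdecay⟩ := exists_avg_decay hn hw (by linarith) hc hd
  obtain ⟨s₀, hνs, hsσ, h1, h2⟩ := exists_exponent (n := n) hν0 hσ
    (fun h => morreyRatio_lt_one hn hp hν hσ hr0 hρ hρσ h)
    (fun h => morreyLebesgueRatio_lt_one (ν := ν) (r := r) hn hp hρσ h)
  have hs1 : 1 ≤ s₀ := by linarith
  have hs0 : 0 < s₀ := by linarith
  obtain ⟨κ, hκ⟩ := exists_powerWeight_le hw hpos hs0 hsσ hd
  have E1 := fun h => exists_maximalWeight_norm_le_morreyNorm hn hw hpos hsσ hd0 hc hd hρ hdecay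
    hp hr0.le (h1 h)
  have E2 := fun h => exists_maximalWeight_norm_le_morreyLebesgueNorm hn hw hpos hsσ hc hd hρ
    hdecay hp (h2 h)
  refine ⟨⟨s₀, hνs, fun h => ?_, fun h => ?_⟩, n / s₀, by positivity, by gcongr,
    fun h => ?_, fun h => ?_⟩
  · obtain ⟨C, hC⟩ := E1 h
    refine ⟨C, fun s hs hs' a ℓ hℓ f hf => ?_⟩
    have hb := hC s (by linarith) hs' a ℓ hℓ f
    exact ⟨hb.trans_lt (ENNReal.mul_lt_top (ENNReal.mul_lt_top ENNReal.coe_lt_top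
      (ENNReal.rpow_lt_top_of_nonneg ht (mass_cube_ne_top hw a ℓ))) hf), hb⟩
  · obtain ⟨C, hC⟩ := E2 h
    refine ⟨C, fun s hs hs' a ℓ hℓ f hf => ?_⟩
    have hb := hC s (by linarith) hs' a ℓ hℓ f
    exact ⟨hb.trans_lt (ENNReal.mul_lt_top (ENNReal.mul_lt_top ENNReal.coe_lt_top
      (ENNReal.rpow_lt_top_of_nonneg ht (volume_cube_ne_top a ℓ))) hf), hb⟩
  · obtain ⟨C, hC⟩ := E1 h
    have hX := ENNReal.rpow_ne_top_of_nonneg ht (mass_cube_ne_top hw 0 2)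
    lift mass w (cube 0 2) ^ (1 / p + r / n) to ℝ≥0 using hX with X hX'
    refine ⟨κ ^ (1 / p) * (C * X), fun f hf => ?_⟩
    have hb := (weightedLpNorm_le_of_le hp hκ f).trans
      (mul_le_mul_right (hC s₀ hs1 le_rfl 0 2 (by norm_num) f) _)
    rw [← hX', ← mul_assoc, ← ENNReal.coe_mul, ← ENNReal.coe_mul] at hb
    exact ⟨hb.trans_lt (ENNReal.mul_lt_top ENNReal.coe_lt_top hf), hb⟩
  · obtain ⟨C, hC⟩ := E2 h
    have hX := ENNReal.rpow_ne_top_of_nonneg ht (volume_cube_ne_top (n := n) 0 2)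
    lift volume (cube (n := n) 0 2) ^ (1 / p + r / n) to ℝ≥0 using hX with X hX'
    refine ⟨κ ^ (1 / p) * (C * X), fun f hf => ?_⟩
    have hb := (weightedLpNorm_le_of_le hp hκ f).trans
      (mul_le_mul_right (hC s₀ hs1 le_rfl 0 2 (by norm_num) f) _)
    rw [← hX', ← mul_assoc, ← ENNReal.coe_mul, ← ENNReal.coe_mul] at hb
    exact ⟨hb.trans_lt (ENNReal.mul_lt_top ENNReal.coe_lt_top hf), hb⟩
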